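/- For integers $n, r \ge 0$ let $W(n,r)$ denote the $n$-dimensional Wishart distribution with $r$ degrees of freedom, i.e. the distribution of the random $n\times n$ matrix $GG^{T}$, where $G\in\mathbb{R}^{n\times r}$ has i.i.d. standard normal entries. For probability measures $\mu,\nu$ on the same measurable space let $\mathrm{TV}(\mu,\nu)=\sup_{S}|\mu(S)-\nu(S)|$ denote their total variation distance, the supremum being over all measurable sets $S$. Let $\alpha = 0.1$. There exists a constant $c$ such that for every integer $r\ge c$, $$\mathrm{TV}\bigl(W(\lfloor \alpha r\rfloor, r),\, W(\lfloor \alpha r\rfloor, r+2)\bigr)\le 0.2 .$$ -/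

import Mathlib

open MeasureTheory ProbabilityTheory Matrix

/-- Real matrices carry the product σ-algebra, which is their Borel σ-algebra. -/
instance realMatrixMeasurableSpace (n r : ℕ) : MeasurableSpace (Matrix (Fin n) (Fin r) ℝ) :=
  inferInstanceAs (MeasurableSpace (Fin n → Fin r → ℝ))

instance realMatrixBorelSpace (n r : ℕ) : BorelSpace (Matrix (Fin n) (Fin r) ℝ) :=
  inferInstanceAs (BorelSpace (Fin n → Fin r → ℝ))

/-- The law of an `n × r` random matrix whose entries are i.i.d. standard normal. -/
noncomputable def gaussianMatrix (n r : ℕ) : Measure (Matrix (Fin n) (Fin r) ℝ) :=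
  (Measure.pi fun _ : Fin n => Measure.pi fun _ : Fin r => gaussianReal 0 1).map Matrix.of

/-- The `n`-dimensional Wishart distribution with `r` degrees of freedom: the law of `G * Gᵀ`,
where `G` is an `n × r` matrix with i.i.d. standard normal entries. -/
noncomputable def wishart (n r : ℕ) : Measure (Matrix (Fin n) (Fin n) ℝ) :=
  (gaussianMatrix n r).map fun G => G * Gᵀ

/-- The total variation distance of two probability measures: the supremum of
`|μ S - ν S|` over all measurable sets `S`. -/
noncomputable def tvDist {Ω : Type*} [MeasurableSpace Ω] (μ ν : Measure Ω)
    [IsProbabilityMeasure μ] [IsProbabilityMeasure ν] : ℝ :=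
  ⨆ S : {S : Set Ω // MeasurableSet S}, |μ.real S - ν.real S|

/-- The supremum in the total variation distance is over a bounded family. -/
theorem bddAbove_tvDist {Ω : Type*} [MeasurableSpace Ω] (μ ν : Measure Ω)
    [IsProbabilityMeasure μ] [IsProbabilityMeasure ν] :
    BddAbove (Set.range fun S : {S : Set Ω // MeasurableSet S} => |μ.real S - ν.real S|) := by
  refine ⟨1, ?_⟩
  rintro _ ⟨S, rfl⟩
  have h1 : μ.real S ≤ 1 := measureReal_le_one
  have h2 : ν.real S ≤ 1 := measureReal_le_one
  have h3 : 0 ≤ μ.real S := measureReal_nonneg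
  have h4 : 0 ≤ ν.real S := measureReal_nonneg
  exact abs_le.2 ⟨by linarith, by linarith⟩

theorem measurable_matrix_of (n r : ℕ) :
    Measurable (Matrix.of : (Fin n → Fin r → ℝ) → Matrix (Fin n) (Fin r) ℝ) :=
  measurable_id

theorem measurable_matrix_entry {n r : ℕ} (i : Fin n) (j : Fin r) :
    Measurable fun G : Matrix (Fin n) (Fin r) ℝ => G i j :=
  (measurable_pi_apply (X := fun _ : Fin r => ℝ) j).comp
    (measurable_pi_apply (X := fun _ : Fin n => Fin r → ℝ) i)

theorem measurable_mul_transpose_self (n r : ℕ) :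
    Measurable fun G : Matrix (Fin n) (Fin r) ℝ => G * Gᵀ := by
  have h : Measurable fun G : Matrix (Fin n) (Fin r) ℝ =>
      (fun i j => ∑ k, G i k * G j k : Fin n → Fin n → ℝ) :=
    measurable_pi_lambda _ fun i => measurable_pi_lambda _ fun j =>
      Finset.measurable_sum _ fun k _ =>
        (measurable_matrix_entry i k).mul (measurable_matrix_entry j k)
  exact h

instance gaussianMatrix_isProbabilityMeasure (n r : ℕ) :
    IsProbabilityMeasure (gaussianMatrix n r) :=
  Measure.isProbabilityMeasure_map (measurable_matrix_of n r).aemeasurable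

instance wishart_isProbabilityMeasure (n r : ℕ) : IsProbabilityMeasure (wishart n r) :=
  Measure.isProbabilityMeasure_map (measurable_mul_transpose_self n r).aemeasurable

/-! Weighting `W(n,r)` by the determinant gives, up to a constant, `W(n,r+2)`. For densities this is
evident; here it is read off Laplace transforms, which also covers singular matrices. Tilting by
`exp tr(Θ G Gᵀ)` amounts to a substitution `G ↦ B⁻¹ G` with `BᵀB = 1 - 2Θ`. It contributes `|det
B|^(-r)`, and the weight `det (G Gᵀ)` contributes two further powers (`lintegral_det_mul_exp_trace`,
`wishart_withDensity_det`).

Hence the likelihood ratio of `W(n,r+2)` to `W(n,r)` is `x = det M / c`, where `c = r!/(r-n)!` is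
the mean determinant (`wishartDetMean_eq`), and the distance is `E|x - 1| / 2`. With `r = s + 8`,
both laws have densities proportional to powers of `det` under `W(n,s)`, so the moments of `x` of
orders `-4` to `6` are explicit quotients of falling factorials. If `n/s → α` and `q = 1/(1-α)`,
then `E x^m → q^(m(m-1))`, the moments of a log-normal variable of mean one.

No limit theorem in law is needed: a polynomial majorant of `x^4 |x - 1|`
(`pow_four_mul_abs_sub_one_le`) bounds the distance by a finite combination of moments
(`tvDist_wishart_le`), and the limit of that combination for `α = 0.1` lies below `0.2`. -/

open scoped ENNReal NNReal

/-! ### Product densities and the Gaussian matrix density -/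

/-- Tonelli's theorem for a product of functions of the separate coordinates. -/
theorem lintegral_fin_prod_eq_prod {n : ℕ} {E : Fin n → Type*} {mE : ∀ i, MeasurableSpace (E i)}
    (μ : (i : Fin n) → Measure (E i)) [∀ i, SigmaFinite (μ i)]
    (f : (i : Fin n) → E i → ℝ≥0∞) (hf : ∀ i, Measurable (f i)) :
    ∫⁻ x : (i : Fin n) → E i, ∏ i, f i (x i) ∂(Measure.pi μ) = ∏ i, ∫⁻ x, f i x ∂(μ i) := by
  induction n with
  | zero => simp
  | succ n ih =>
    have h := ((measurePreserving_piFinSuccAbove μ 0).symm).lintegral_comp_emb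
      (MeasurableEquiv.measurableEmbedding _) (fun x => ∏ i, f i (x i))
    rw [← h]
    simp_rw [MeasurableEquiv.piFinSuccAbove_symm_apply, Fin.insertNthEquiv,
      Fin.prod_univ_succ, Fin.insertNth_zero, Equiv.coe_fn_mk, Fin.cons_succ,
      Fin.zero_succAbove, Fin.cons_zero]
    rw [← ih (fun i => μ i.succ) (fun i => f i.succ) fun i => hf _]
    exact lintegral_prod_mul (μ := μ 0) (ν := Measure.pi fun i : Fin n => μ i.succ)
      (g := fun x : (i : Fin n) → E i.succ => ∏ i, f i.succ (x i)) (hf 0).aemeasurable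
      (Finset.measurable_prod _ fun i _ => (hf _).comp (measurable_pi_apply i)).aemeasurable

/-- A finite product of measures with densities has the product density. -/
theorem pi_withDensity {n : ℕ} {E : Fin n → Type*} {mE : ∀ i, MeasurableSpace (E i)}
    (μ : (i : Fin n) → Measure (E i)) [∀ i, SigmaFinite (μ i)]
    (f : (i : Fin n) → E i → ℝ≥0∞) (hf : ∀ i, Measurable (f i))
    [∀ i, SigmaFinite ((μ i).withDensity (f i))] :
    Measure.pi (fun i => (μ i).withDensity (f i)) =
      (Measure.pi μ).withDensity fun x => ∏ i, f i (x i) := by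
  refine Measure.pi_eq fun s hs => ?_
  rw [withDensity_apply _ (MeasurableSet.univ_pi hs),
    ← lintegral_indicator (MeasurableSet.univ_pi hs)]
  have h : ((Set.univ.pi s).indicator fun x : (i : Fin n) → E i => ∏ i, f i (x i)) =
      fun x => ∏ i, (s i).indicator (f i) (x i) := by
    funext x
    by_cases hx : x ∈ Set.univ.pi s
    · rw [Set.indicator_of_mem hx]
      exact Finset.prod_congr rfl fun i _ => (Set.indicator_of_mem (hx i trivial) _).symm
    · rw [Set.indicator_of_notMem hx]
      obtain ⟨i, hi⟩ : ∃ i, x i ∉ s i := by simpa [Set.mem_pi] using hx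
      exact (Finset.prod_eq_zero (Finset.mem_univ i) (Set.indicator_of_notMem hi _)).symm
  rw [h, lintegral_fin_prod_eq_prod μ _ fun i => (hf i).indicator (hs i)]
  exact Finset.prod_congr rfl fun i _ => by
    rw [lintegral_indicator (hs i), withDensity_apply _ (hs i)]

/-- The density of the law of a Gaussian matrix with respect to Lebesgue measure. -/
noncomputable def gaussianMatrixDensity (n r : ℕ) (G : Fin n → Fin r → ℝ) : ℝ :=
  (Real.sqrt (2 * Real.pi))⁻¹ ^ (r * n) * Real.exp (-(∑ i, ∑ k, G i k ^ 2) / 2)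

theorem measurable_gaussianMatrixDensity (n r : ℕ) : Measurable (gaussianMatrixDensity n r) := by
  unfold gaussianMatrixDensity; fun_prop

theorem prod_gaussianPDF_eq (n r : ℕ) (G : Fin n → Fin r → ℝ) :
    ∏ i, ∏ k, gaussianPDF 0 1 (G i k) = ENNReal.ofReal (gaussianMatrixDensity n r G) := by
  simp_rw [gaussianPDF]
  have h : ∀ i, ∏ k, ENNReal.ofReal (gaussianPDFReal 0 1 (G i k)) =
      ENNReal.ofReal (∏ k, gaussianPDFReal 0 1 (G i k)) := fun i =>
    (ENNReal.ofReal_prod_of_nonneg fun k _ => gaussianPDFReal_nonneg _ _ _).symm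
  simp_rw [h]
  rw [← ENNReal.ofReal_prod_of_nonneg
    fun i _ => Finset.prod_nonneg fun k _ => gaussianPDFReal_nonneg _ _ _]
  congr 1
  simp only [gaussianPDFReal, gaussianMatrixDensity, sub_zero, NNReal.coe_one, mul_one,
    Finset.prod_mul_distrib, Finset.prod_const, Finset.card_univ, Fintype.card_fin,
    ← Real.exp_sum, ← pow_mul, Finset.sum_div, Finset.sum_neg_distrib, neg_div]

theorem gaussianPi_eq_withDensity (n r : ℕ) :
    (Measure.pi fun _ : Fin n => Measure.pi fun _ : Fin r => gaussianReal 0 1) =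
      (volume : Measure (Fin n → Fin r → ℝ)).withDensity
        fun G => ENNReal.ofReal (gaussianMatrixDensity n r G) := by
  have h0 : gaussianReal 0 1 = (volume : Measure ℝ).withDensity (gaussianPDF 0 1) :=
    gaussianReal_of_var_ne_zero 0 one_ne_zero
  have : IsProbabilityMeasure ((volume : Measure ℝ).withDensity (gaussianPDF 0 1)) := by
    rw [← h0]; infer_instance
  have h1 : (Measure.pi fun _ : Fin r => gaussianReal 0 1) =
      (volume : Measure (Fin r → ℝ)).withDensity fun x => ∏ k, gaussianPDF 0 1 (x k) := by
    rw [h0]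
    exact pi_withDensity (fun _ : Fin r => (volume : Measure ℝ)) _
      fun _ => measurable_gaussianPDF 0 1
  have : IsProbabilityMeasure ((volume : Measure (Fin r → ℝ)).withDensity
      fun x => ∏ k, gaussianPDF 0 1 (x k)) := by
    rw [← h1]; infer_instance
  rw [h1]
  have h2 := pi_withDensity (fun _ : Fin n => (volume : Measure (Fin r → ℝ)))
    (fun _ x => ∏ k, gaussianPDF 0 1 (x k))
    fun _ => Finset.measurable_prod _
      fun k _ => (measurable_gaussianPDF 0 1).comp (measurable_pi_apply k)
  rw [h2]
  simp_rw [prod_gaussianPDF_eq]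
  rfl

/-! ### Linear changes of variables and exponential tilting -/

/-- Left multiplication by a square matrix, on matrices given as functions. -/
noncomputable def mulLeftPi {n : ℕ} (r : ℕ) (A : Matrix (Fin n) (Fin n) ℝ) :
    (Fin n → Fin r → ℝ) →ₗ[ℝ] (Fin n → Fin r → ℝ) where
  toFun G := (A * Matrix.of G : Matrix (Fin n) (Fin r) ℝ)
  map_add' G H := Matrix.mul_add A (Matrix.of G) (Matrix.of H)
  map_smul' c G := Matrix.mul_smul A c (Matrix.of G)

/-- Transposition, on matrices given as functions. -/
def piSwapLinearEquiv (n r : ℕ) : (Fin r → Fin n → ℝ) ≃ₗ[ℝ] (Fin n → Fin r → ℝ) where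
  toFun G i k := G k i
  invFun G k i := G i k
  map_add' _ _ := rfl
  map_smul' _ _ := rfl

/-- Transposition conjugates the map to `r` independent copies of `A`, one acting on each column. -/
theorem det_mulLeftPi {n : ℕ} (r : ℕ) (A : Matrix (Fin n) (Fin n) ℝ) :
    LinearMap.det (mulLeftPi r A) = A.det ^ r := by
  have h := LinearMap.det_pi (fun _ : Fin r => Matrix.toLin' A)
  simp only [LinearMap.det_toLin', Finset.prod_const, Finset.card_univ, Fintype.card_fin] at h
  rw [← h, ← LinearMap.det_conj _ (piSwapLinearEquiv n r)]
  rfl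

theorem lintegral_gaussianMatrix {n r : ℕ} {F : Matrix (Fin n) (Fin r) ℝ → ℝ≥0∞}
    (hF : Measurable F) :
    ∫⁻ G, F G ∂(gaussianMatrix n r) =
      ∫⁻ G : Fin n → Fin r → ℝ, F (Matrix.of G) * ENNReal.ofReal (gaussianMatrixDensity n r G) := by
  rw [gaussianMatrix, lintegral_map hF (measurable_matrix_of n r), gaussianPi_eq_withDensity]
  refine (lintegral_withDensity_eq_lintegral_mul _
    (measurable_gaussianMatrixDensity n r).ennreal_ofReal
    (hF.comp (measurable_matrix_of n r))).trans ?_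
  simp only [Pi.mul_apply, Function.comp_apply, mul_comm]

theorem trace_mul_transpose_eq_sum_sq {n r : ℕ} (G : Matrix (Fin n) (Fin r) ℝ) :
    (G * Gᵀ).trace = ∑ i, ∑ k, G i k ^ 2 := by
  simp [Matrix.trace, Matrix.mul_apply, sq]

theorem gaussianMatrixDensity_mul_left {n r : ℕ} {Θ B : Matrix (Fin n) (Fin n) ℝ}
    (hB : Bᵀ * B = 1 - (2 : ℝ) • Θ) (H : Matrix (Fin n) (Fin r) ℝ) :
    gaussianMatrixDensity n r (B * H) =
      Real.exp (Θ * (H * Hᵀ)).trace * gaussianMatrixDensity n r H := by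
  have h : ((B * H) * (B * H)ᵀ).trace = (H * Hᵀ).trace - 2 * (Θ * (H * Hᵀ)).trace := by
    rw [Matrix.transpose_mul, Matrix.mul_assoc, Matrix.trace_mul_comm, Matrix.mul_assoc,
      Matrix.mul_assoc, hB, ← Matrix.mul_assoc, Matrix.mul_sub, Matrix.trace_sub, Matrix.mul_one,
      Matrix.mul_smul, Matrix.trace_smul, smul_eq_mul, Matrix.trace_mul_comm _ Θ]
  have hd : ∀ G : Matrix (Fin n) (Fin r) ℝ, gaussianMatrixDensity n r G =
      (Real.sqrt (2 * Real.pi))⁻¹ ^ (r * n) * Real.exp (-(G * Gᵀ).trace / 2) := fun G => by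
    rw [trace_mul_transpose_eq_sum_sq]; rfl
  rw [hd, hd, h, mul_left_comm, ← Real.exp_add]
  congr 2
  ring

/-- Exponential tilting of a Gaussian matrix amounts to a linear change of variables. -/
theorem lintegral_exp_trace_gaussianMatrix {n r : ℕ} {Θ B : Matrix (Fin n) (Fin n) ℝ}
    (hB : Bᵀ * B = 1 - (2 : ℝ) • Θ) (hdet : B.det ≠ 0)
    {F : Matrix (Fin n) (Fin r) ℝ → ℝ≥0∞} (hF : Measurable F) :
    ∫⁻ H, F H * ENNReal.ofReal (Real.exp (Θ * (H * Hᵀ)).trace) ∂(gaussianMatrix n r) =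
      ENNReal.ofReal |(B.det ^ r)⁻¹| * ∫⁻ G, F (B⁻¹ * G) ∂(gaussianMatrix n r) := by
  have hm : Measurable fun G : Matrix (Fin n) (Fin r) ℝ => F (B⁻¹ * G) :=
    hF.comp (by fun_prop : Continuous fun G : Matrix (Fin n) (Fin r) ℝ => B⁻¹ * G).measurable
  have he : Measurable fun H : Matrix (Fin n) (Fin r) ℝ =>
      ENNReal.ofReal (Real.exp (Θ * (H * Hᵀ)).trace) :=
    (by fun_prop : Continuous fun H : Matrix (Fin n) (Fin r) ℝ =>
      Real.exp (Θ * (H * Hᵀ)).trace).measurable.ennreal_ofReal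
  have hFe : Measurable fun H : Matrix (Fin n) (Fin r) ℝ =>
      F H * ENNReal.ofReal (Real.exp (Θ * (H * Hᵀ)).trace) := hF.mul he
  rw [lintegral_gaussianMatrix hFe, lintegral_gaussianMatrix hm]
  have hT : LinearMap.det (mulLeftPi r B) ≠ 0 := by
    rw [det_mulLeftPi]; exact pow_ne_zero _ hdet
  -- The substitution is `G = B * H`; its Jacobian supplies the factor `|det B|^(-r)`.
  have hmap := Measure.map_linearMap_addHaar_eq_smul_addHaar
    (volume : Measure (Fin n → Fin r → ℝ)) hT
  rw [det_mulLeftPi] at hmap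
  have hTm : Measurable (mulLeftPi r B) :=
    (LinearMap.continuous_of_finiteDimensional (mulLeftPi r B)).measurable
  have hg : Measurable fun G : Fin n → Fin r → ℝ =>
      F (B⁻¹ * Matrix.of G) * ENNReal.ofReal (gaussianMatrixDensity n r G) :=
    (hm.comp (measurable_matrix_of n r)).mul (measurable_gaussianMatrixDensity n r).ennreal_ofReal
  rw [← smul_eq_mul, ← lintegral_smul_measure, ← hmap, lintegral_map hg hTm]
  refine lintegral_congr fun H => ?_
  have h1 : Matrix.of (mulLeftPi r B H) = B * Matrix.of H := rfl
  have h2 : gaussianMatrixDensity n r (mulLeftPi r B H) =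
      Real.exp (Θ * (Matrix.of H * (Matrix.of H)ᵀ)).trace * gaussianMatrixDensity n r H :=
    gaussianMatrixDensity_mul_left hB (Matrix.of H)
  rw [h1, h2, ← Matrix.mul_assoc B⁻¹, Matrix.nonsing_inv_mul _ (isUnit_iff_ne_zero.2 hdet),
    Matrix.one_mul, ENNReal.ofReal_mul (Real.exp_pos _).le, mul_assoc]

/-! ### The Laplace transform weighted by the determinant -/

theorem det_mul_transpose_self_nonneg {n r : ℕ} (G : Matrix (Fin n) (Fin r) ℝ) :
    0 ≤ (G * Gᵀ).det := by
  have h := (Matrix.posSemidef_self_mul_conjTranspose G).det_nonneg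
  rwa [Matrix.conjTranspose_eq_transpose_of_trivial] at h

theorem continuous_det_mul_transpose_self (n r : ℕ) :
    Continuous fun G : Matrix (Fin n) (Fin r) ℝ => (G * Gᵀ).det := by
  fun_prop

/-- The Laplace transform of `G * Gᵀ` weighted by its determinant is, up to the total mass, the
Laplace transform for two more degrees of freedom. -/
theorem lintegral_det_mul_exp_trace {n r : ℕ} {Θ B : Matrix (Fin n) (Fin n) ℝ}
    (hB : Bᵀ * B = 1 - (2 : ℝ) • Θ) (hdet : B.det ≠ 0) :
    ∫⁻ H, ENNReal.ofReal (H * Hᵀ).det * ENNReal.ofReal (Real.exp (Θ * (H * Hᵀ)).trace)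
        ∂(gaussianMatrix n r) =
      (∫⁻ H, ENNReal.ofReal (H * Hᵀ).det ∂(gaussianMatrix n r)) *
        ∫⁻ H, ENNReal.ofReal (Real.exp (Θ * (H * Hᵀ)).trace) ∂(gaussianMatrix n (r + 2)) := by
  have hm := (continuous_det_mul_transpose_self n r).measurable.ennreal_ofReal
  -- The unweighted transform for `r + 2` columns is `|det B|^(-(r+2))`.
  have h1 := lintegral_exp_trace_gaussianMatrix (r := r + 2) hB hdet (F := fun _ => 1)
    measurable_const
  simp only [one_mul, lintegral_one, measure_univ, mul_one] at h1
  rw [lintegral_exp_trace_gaussianMatrix hB hdet hm, h1]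
  have h2 : ∀ G : Matrix (Fin n) (Fin r) ℝ, ENNReal.ofReal ((B⁻¹ * G) * (B⁻¹ * G)ᵀ).det =
      ENNReal.ofReal |(B.det ^ 2)⁻¹| * ENNReal.ofReal (G * Gᵀ).det := by
    intro G
    rw [← ENNReal.ofReal_mul (abs_nonneg _), Matrix.transpose_mul, Matrix.mul_assoc,
      ← Matrix.mul_assoc G, ← Matrix.mul_assoc, Matrix.det_mul, Matrix.det_mul,
      Matrix.det_transpose, Matrix.det_nonsing_inv, Ring.inverse_eq_inv',
      abs_of_pos (by positivity)]
    congr 1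
    ring
  simp_rw [h2]
  rw [lintegral_const_mul _ hm, ← mul_assoc, ← ENNReal.ofReal_mul (abs_nonneg _), mul_comm,
    ← abs_mul, ← mul_inv, ← pow_add]

/-! ### Uniqueness from Laplace transforms near zero -/

theorem integrable_exp_of_lintegral_ne_top {Ω : Type*} [MeasurableSpace Ω] {μ : Measure Ω}
    {X : Ω → ℝ} (hX : Measurable X) {t : ℝ}
    (ht : ∫⁻ ω, ENNReal.ofReal (Real.exp (t * X ω)) ∂μ ≠ ∞) :
    Integrable (fun ω => Real.exp (t * X ω)) μ :=
  (lintegral_ofReal_ne_top_iff_integrable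
    (Real.measurable_exp.comp (hX.const_mul t)).aestronglyMeasurable
    (ae_of_all _ fun _ => (Real.exp_pos _).le)).1 ht

/-- If the Laplace transforms of two real random variables are finite and agree near zero, then
their characteristic functions agree. -/
theorem complexMGF_eq_of_lintegral_exp_eq {Ω Ω' : Type*} [MeasurableSpace Ω] [MeasurableSpace Ω']
    {μ : Measure Ω} {ν : Measure Ω'} {X : Ω → ℝ} {Y : Ω' → ℝ} (hX : Measurable X)
    (hY : Measurable Y) {δ : ℝ} (hδ : 0 < δ)
    (hfin : ∀ t : ℝ, |t| < δ → ∫⁻ ω, ENNReal.ofReal (Real.exp (t * X ω)) ∂μ ≠ ∞)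
    (heq : ∀ t : ℝ, |t| < δ → ∫⁻ ω, ENNReal.ofReal (Real.exp (t * X ω)) ∂μ =
      ∫⁻ ω, ENNReal.ofReal (Real.exp (t * Y ω)) ∂ν) (w : ℝ) :
    complexMGF X μ (w * Complex.I) = complexMGF Y ν (w * Complex.I) := by
  have hball : ∀ t ∈ Set.Ioo (-δ) δ, |t| < δ := fun t ht => abs_lt.2 ht
  have hXs : Set.Ioo (-δ) δ ⊆ interior (integrableExpSet X μ) :=
    interior_maximal (fun t ht => integrable_exp_of_lintegral_ne_top hX (hfin t (hball t ht)))
      isOpen_Ioo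
  have hYs : Set.Ioo (-δ) δ ⊆ interior (integrableExpSet Y ν) :=
    interior_maximal (fun t ht => integrable_exp_of_lintegral_ne_top hY
      (by rw [← heq t (hball t ht)]; exact hfin t (hball t ht))) isOpen_Ioo
  have hpre : IsPreconnected {z : ℂ | z.re ∈ Set.Ioo (-δ) δ} :=
    ((convex_Ioo (-δ) δ).linear_preimage Complex.reLm).isPreconnected
  have hmgf : ∀ t ∈ Set.Ioo (-δ) δ, complexMGF X μ t = complexMGF Y ν t := by
    intro t ht
    rw [complexMGF_ofReal, complexMGF_ofReal, mgf, mgf,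
      integral_eq_lintegral_of_nonneg_ae (ae_of_all _ fun _ => (Real.exp_pos _).le)
        (Real.measurable_exp.comp (hX.const_mul t)).aestronglyMeasurable,
      integral_eq_lintegral_of_nonneg_ae (ae_of_all _ fun _ => (Real.exp_pos _).le)
        (Real.measurable_exp.comp (hY.const_mul t)).aestronglyMeasurable, heq t (hball t ht)]
  -- Identity theorem on the strip `|Re z| < δ`: agreement on a real interval around `0` extends to
  -- the imaginary axis.
  refine AnalyticOnNhd.eqOn_of_preconnected_of_frequently_eq
    (analyticOnNhd_complexMGF.mono fun z hz => hXs hz)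
    (analyticOnNhd_complexMGF.mono fun z hz => hYs hz) hpre (z₀ := ((0 : ℝ) : ℂ))
    (show ((0 : ℝ) : ℂ).re ∈ Set.Ioo (-δ) δ by simp [hδ]) ?_
    (show ((w : ℂ) * Complex.I).re ∈ Set.Ioo (-δ) δ by simp [hδ])
  have hreal : ∃ᶠ x : ℝ in nhdsWithin 0 {0}ᶜ, complexMGF X μ x = complexMGF Y ν x := by
    refine Filter.Eventually.frequently ?_
    filter_upwards [nhdsWithin_le_nhds (Ioo_mem_nhds (neg_lt_zero.2 hδ) hδ)] with t ht
      using hmgf t ht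
  rw [Filter.frequently_iff_seq_forall] at hreal ⊢
  obtain ⟨xs, hxs, hxe⟩ := hreal
  refine ⟨fun n => xs n, ?_, hxe⟩
  rw [tendsto_nhdsWithin_iff] at hxs ⊢
  exact ⟨Filter.tendsto_ofReal_iff.2 hxs.1, by simpa using hxs.2⟩

open scoped MatrixOrder in
/-- Small perturbations of the identity by a symmetric matrix are Gram matrices of invertible
matrices. -/
theorem exists_transpose_mul_self_eq_one_sub {n : ℕ} {Θ : Matrix (Fin n) (Fin n) ℝ}
    (hΘ : Θᵀ = Θ) (hs : 2 * ∑ i, ∑ j, |Θ i j| < 1) :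
    ∃ B : Matrix (Fin n) (Fin n) ℝ, Bᵀ * B = 1 - (2 : ℝ) • Θ ∧ B.det ≠ 0 := by
  have hpd : (1 - (2 : ℝ) • Θ).PosDef := by
    refine PosDef.of_dotProduct_mulVec_pos ?_ fun {x} hx => ?_
    · rw [Matrix.IsHermitian, Matrix.conjTranspose_eq_transpose_of_trivial]
      simp [hΘ]
    · have hxx : 0 < x ⬝ᵥ x := by
        have := Matrix.dotProduct_star_self_pos_iff.2 hx
        simpa using this
      -- The quadratic form of `Θ` is at most its entrywise `ℓ¹` norm times `|x|²`, so `1 - 2Θ`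
      -- stays positive definite.
      have hq : x ⬝ᵥ (Θ *ᵥ x) ≤ (∑ i, ∑ j, |Θ i j|) * (x ⬝ᵥ x) := by
        have hsq : ∀ i, x i ^ 2 ≤ x ⬝ᵥ x := fun i => by
          rw [dotProduct, sq]
          exact Finset.single_le_sum (f := fun i => x i * x i)
            (fun j _ => mul_self_nonneg _) (Finset.mem_univ i)
        have he : x ⬝ᵥ (Θ *ᵥ x) = ∑ i, ∑ j, x i * (Θ i j * x j) := by
          simp_rw [dotProduct, Matrix.mulVec, dotProduct, Finset.mul_sum]
        rw [he, Finset.sum_mul]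
        simp_rw [Finset.sum_mul]
        refine Finset.sum_le_sum fun i _ => Finset.sum_le_sum fun j _ => ?_
        have h1 : |x i * x j| ≤ x ⬝ᵥ x := by
          have := abs_mul (x i) (x j)
          nlinarith [hsq i, hsq j, sq_nonneg (|x i| - |x j|), sq_abs (x i), sq_abs (x j)]
        calc x i * (Θ i j * x j) ≤ |x i * (Θ i j * x j)| := le_abs_self _
          _ = |Θ i j| * |x i * x j| := by rw [← abs_mul]; congr 1; ring
          _ ≤ |Θ i j| * (x ⬝ᵥ x) := mul_le_mul_of_nonneg_left h1 (abs_nonneg _)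
      rw [star_trivial, Matrix.sub_mulVec, Matrix.one_mulVec, Matrix.smul_mulVec, dotProduct_sub,
        dotProduct_smul, smul_eq_mul]
      nlinarith
  obtain ⟨B, hB⟩ := CStarAlgebra.nonneg_iff_eq_star_mul_self.1 hpd.posSemidef.nonneg
  rw [Matrix.star_eq_conjTranspose, Matrix.conjTranspose_eq_transpose_of_trivial] at hB
  refine ⟨B, hB.symm, fun h0 => ?_⟩
  have := hpd.det_pos
  rw [hB, Matrix.det_mul, h0, mul_zero] at this
  exact lt_irrefl _ this

/-- Finite measures on square matrices are determined by the Laplace transforms near zero of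
the linear functionals. -/
theorem ext_of_lintegral_exp_eq {n : ℕ} {μ ν : Measure (Matrix (Fin n) (Fin n) ℝ)}
    [IsFiniteMeasure μ] [IsFiniteMeasure ν]
    (h : ∀ ℓ : Fin n → Fin n → ℝ, ∃ δ > 0, ∀ t : ℝ, |t| < δ →
      ∫⁻ M, ENNReal.ofReal (Real.exp (t * ∑ i, ∑ j, ℓ i j * M i j)) ∂μ ≠ ∞ ∧
      ∫⁻ M, ENNReal.ofReal (Real.exp (t * ∑ i, ∑ j, ℓ i j * M i j)) ∂μ =
        ∫⁻ M, ENNReal.ofReal (Real.exp (t * ∑ i, ∑ j, ℓ i j * M i j)) ∂ν) :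
    μ = ν := by
  -- Characteristic functions on the dual need a normed space; the function type carries the sup
  -- norm.
  let μ' : Measure (Fin n → Fin n → ℝ) := μ
  let ν' : Measure (Fin n → Fin n → ℝ) := ν
  have : IsFiniteMeasure μ' := ‹IsFiniteMeasure μ›
  have : IsFiniteMeasure ν' := ‹IsFiniteMeasure ν›
  have hmain : μ' = ν' := by
    refine Measure.ext_of_charFunDual (funext fun L => ?_)
    obtain ⟨ℓ, hL⟩ : ∃ ℓ : Fin n → Fin n → ℝ, ∀ x : Fin n → Fin n → ℝ,
        L x = ∑ i, ∑ j, ℓ i j * x i j := by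
      refine ⟨fun i j => L (Pi.single i (Pi.single j 1)), fun x => ?_⟩
      have hx : x = ∑ i, ∑ j, x i j • (Pi.single i (Pi.single j 1) : Fin n → Fin n → ℝ) := by
        ext a b
        simp [Finset.sum_apply, Pi.single_apply, ite_apply]
      conv_lhs => rw [hx]
      simp only [map_sum, map_smul, smul_eq_mul, mul_comm]
    obtain ⟨δ, hδ, ht⟩ := h ℓ
    have hLm : Measurable fun x : Fin n → Fin n → ℝ => L x := L.continuous.measurable
    have key := complexMGF_eq_of_lintegral_exp_eq (μ := μ') (ν := ν') hLm hLm hδ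
      (fun t h' => by simp_rw [hL]; exact (ht t h').1)
      (fun t h' => by simp_rw [hL]; exact (ht t h').2) 1
    simp only [complexMGF, Complex.ofReal_one, one_mul] at key
    simpa only [charFunDual_apply, mul_comm] using key
  exact hmain

/-! ### The determinant as a likelihood ratio -/

/-- The mean of the determinant of a Wishart matrix. -/
noncomputable def wishartDetMean (n r : ℕ) : ℝ≥0∞ :=
  ∫⁻ M, ENNReal.ofReal M.det ∂(wishart n r)

theorem measurable_det (n : ℕ) : Measurable fun M : Matrix (Fin n) (Fin n) ℝ => M.det :=
  (by fun_prop : Continuous fun M : Matrix (Fin n) (Fin n) ℝ => M.det).measurable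

theorem lintegral_wishart {n r : ℕ} {f : Matrix (Fin n) (Fin n) ℝ → ℝ≥0∞} (hf : Measurable f) :
    ∫⁻ M, f M ∂(wishart n r) = ∫⁻ G, f (G * Gᵀ) ∂(gaussianMatrix n r) :=
  lintegral_map hf (measurable_mul_transpose_self n r)

/-- Weighting the Wishart distribution by the determinant adds two degrees of freedom. -/
theorem wishart_withDensity_det {n r : ℕ} (hc : wishartDetMean n r ≠ ∞) :
    (wishart n r).withDensity (fun M => ENNReal.ofReal M.det) =
      wishartDetMean n r • wishart n (r + 2) := by
  have hd := (measurable_det n).ennreal_ofReal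
  have : IsFiniteMeasure ((wishart n r).withDensity fun M => ENNReal.ofReal M.det) :=
    isFiniteMeasure_withDensity hc
  have : IsFiniteMeasure (wishartDetMean n r • wishart n (r + 2)) :=
    Measure.smul_finite _ hc
  refine ext_of_lintegral_exp_eq fun ℓ => ?_
  set S : ℝ := ∑ i, ∑ j, |(ℓ i j + ℓ j i) / 2| with hS
  have hS0 : 0 ≤ S := Finset.sum_nonneg fun i _ => Finset.sum_nonneg fun j _ => abs_nonneg _
  -- This radius forces `2 * |t| * S < 1`, the smallness condition on `Θ`.
  refine ⟨1 / (2 * S + 1), by positivity, fun t ht => ?_⟩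
  have he : Measurable fun M : Matrix (Fin n) (Fin n) ℝ =>
      ENNReal.ofReal (Real.exp (t * ∑ i, ∑ j, ℓ i j * M i j)) := by
    refine (Real.measurable_exp.comp (Measurable.const_mul ?_ t)).ennreal_ofReal
    exact Finset.measurable_sum _ fun i _ => Finset.measurable_sum _ fun j _ =>
      (measurable_matrix_entry i j).const_mul _
  -- Since `G * Gᵀ` is symmetric, only the symmetric part of `ℓ` matters, and a symmetric `Θ` is
  -- what admits a factor `B`.
  let Θ : Matrix (Fin n) (Fin n) ℝ := Matrix.of fun i j => t * ((ℓ i j + ℓ j i) / 2)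
  have hΘ : Θᵀ = Θ := by ext i j; simp [Θ, add_comm]
  have hs : 2 * ∑ i, ∑ j, |Θ i j| < 1 := by
    have h1 : ∑ i, ∑ j, |Θ i j| = |t| * S := by
      rw [hS, Finset.mul_sum]
      exact Finset.sum_congr rfl fun i _ => by
        rw [Finset.mul_sum]; exact Finset.sum_congr rfl fun j _ => abs_mul _ _
    rw [h1]
    rw [lt_div_iff₀ (by positivity)] at ht
    nlinarith [abs_nonneg t, mul_nonneg (abs_nonneg t) hS0]
  obtain ⟨B, hB, hdet⟩ := exists_transpose_mul_self_eq_one_sub hΘ hs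
  have htr : ∀ {r : ℕ} (G : Matrix (Fin n) (Fin r) ℝ),
      t * ∑ i, ∑ j, ℓ i j * (G * Gᵀ) i j = (Θ * (G * Gᵀ)).trace := by
    intro r G
    have hsymm : ∀ i j, (G * Gᵀ) i j = (G * Gᵀ) j i := fun i j => by
      simp [Matrix.mul_apply, mul_comm]
    have h1 : (Θ * (G * Gᵀ)).trace =
        ∑ i, ∑ j, (t * (ℓ i j / 2) * (G * Gᵀ) i j + t * (ℓ j i / 2) * (G * Gᵀ) j i) := by
      rw [Matrix.trace]
      refine Finset.sum_congr rfl fun i _ => ?_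
      rw [Matrix.diag_apply, Matrix.mul_apply]
      refine Finset.sum_congr rfl fun j _ => ?_
      rw [hsymm j i]
      simp only [Θ, Matrix.of_apply]
      ring
    rw [h1]
    simp_rw [Finset.sum_add_distrib]
    rw [Finset.sum_comm (f := fun i j => t * (ℓ j i / 2) * (G * Gᵀ) j i), ← Finset.sum_add_distrib,
      Finset.mul_sum]
    refine Finset.sum_congr rfl fun i _ => ?_
    rw [← Finset.sum_add_distrib, Finset.mul_sum]
    exact Finset.sum_congr rfl fun j _ => by ring
  have hL : ∫⁻ M, ENNReal.ofReal (Real.exp (t * ∑ i, ∑ j, ℓ i j * M i j))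
      ∂((wishart n r).withDensity fun M => ENNReal.ofReal M.det) =
      wishartDetMean n r * ∫⁻ H, ENNReal.ofReal (Real.exp (Θ * (H * Hᵀ)).trace)
        ∂(gaussianMatrix n (r + 2)) := by
    rw [lintegral_withDensity_eq_lintegral_mul _ hd he, lintegral_wishart (hd.mul he),
      wishartDetMean, lintegral_wishart hd, ← lintegral_det_mul_exp_trace hB hdet]
    simp only [Pi.mul_apply, htr]
  have hR : ∫⁻ M, ENNReal.ofReal (Real.exp (t * ∑ i, ∑ j, ℓ i j * M i j))
      ∂(wishartDetMean n r • wishart n (r + 2)) =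
      wishartDetMean n r * ∫⁻ H, ENNReal.ofReal (Real.exp (Θ * (H * Hᵀ)).trace)
        ∂(gaussianMatrix n (r + 2)) := by
    rw [lintegral_smul_measure, lintegral_wishart he, smul_eq_mul]
    simp only [htr]
  refine ⟨?_, hL.trans hR.symm⟩
  rw [hL]
  have h1 := lintegral_exp_trace_gaussianMatrix (r := r + 2) hB hdet (F := fun _ => 1)
    measurable_const
  simp only [one_mul, lintegral_one, measure_univ, mul_one] at h1
  rw [h1]
  exact ENNReal.mul_ne_top hc ENNReal.ofReal_ne_top

/-! ### The mean determinant -/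

theorem integrable_sq_gaussianReal : Integrable (fun x : ℝ => x * x) (gaussianReal 0 1) := by
  simpa [sq] using (memLp_id_gaussianReal 2 (μ := 0) (v := 1)).integrable_sq

theorem integrable_id_gaussianReal : Integrable (fun x : ℝ => x) (gaussianReal 0 1) :=
  (memLp_id_gaussianReal 1).integrable le_rfl

theorem integral_mul_self_gaussianReal : ∫ x, x * x ∂(gaussianReal 0 1) = 1 := by
  have h := variance_fun_id_gaussianReal (μ := 0) (v := 1)
  rw [variance_eq_integral measurable_id'.aemeasurable, integral_id_gaussianReal] at h
  simpa [sq] using h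

/-- The coordinates of a standard Gaussian vector are orthonormal. -/
theorem integrable_and_integral_mul_gaussianPi {r : ℕ} (p q : Fin r) :
    Integrable (fun x : Fin r → ℝ => x p * x q) (Measure.pi fun _ => gaussianReal 0 1) ∧
      ∫ x : Fin r → ℝ, x p * x q ∂(Measure.pi fun _ => gaussianReal 0 1) =
        if p = q then 1 else 0 := by
  have h : (fun x : Fin r → ℝ => x p * x q) =
      fun x => ∏ k, ((if k = p then x k else 1) * (if k = q then x k else 1)) := by
    funext x
    rw [Finset.prod_mul_distrib, Finset.prod_ite_eq' _ p, Finset.prod_ite_eq' _ q]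
    simp
  have hi : ∀ k : Fin r, Integrable
      (fun y : ℝ => (if k = p then y else 1) * (if k = q then y else 1)) (gaussianReal 0 1) := by
    intro k
    by_cases h1 : k = p <;> by_cases h2 : k = q
    · simpa only [if_pos h1, if_pos h2] using integrable_sq_gaussianReal
    · simpa only [if_pos h1, if_neg h2, mul_one] using integrable_id_gaussianReal
    · simpa only [if_neg h1, if_pos h2, one_mul] using integrable_id_gaussianReal
    · simpa only [if_neg h1, if_neg h2] using integrable_const _
  rw [h]
  refine ⟨Integrable.fintype_prod (f := fun k y => (if k = p then y else 1) *
    (if k = q then y else 1)) hi, ?_⟩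
  rw [integral_fintype_prod_eq_prod (fun k y => (if k = p then y else 1) *
    (if k = q then y else 1))]
  split_ifs with hpq
  · subst hpq
    refine Finset.prod_eq_one fun k _ => ?_
    by_cases h1 : k = p
    · simpa [h1] using integral_mul_self_gaussianReal
    · simp [h1]
  · refine Finset.prod_eq_zero (Finset.mem_univ p) ?_
    simp [hpq, integral_id_gaussianReal]

/-- Leibniz expansion, with `f i` the column index in the `i`-th entry. Reindexing by `σ` collects
row `i` of `G` in the `i`-th factor, so that independence of the rows applies. -/
theorem det_mul_transpose_eq_sum {n r : ℕ} (G : Fin n → Fin r → ℝ) :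
    (Matrix.of G * (Matrix.of G)ᵀ).det = ∑ f : Fin n → Fin r, ∑ σ : Equiv.Perm (Fin n),
      ((Equiv.Perm.sign σ : ℤ) : ℝ) * ∏ i, (G i (f (σ⁻¹ i)) * G i (f i)) := by
  rw [Matrix.det_apply', Finset.sum_comm]
  refine Finset.sum_congr rfl fun σ _ => ?_
  rw [← Finset.mul_sum]
  congr 1
  simp only [Matrix.mul_apply, Matrix.transpose_apply, Matrix.of_apply]
  rw [Finset.prod_univ_sum, Fintype.piFinset_univ]
  refine Finset.sum_congr rfl fun f _ => ?_
  rw [Finset.prod_mul_distrib, Finset.prod_mul_distrib]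
  congr 1
  rw [← Equiv.prod_comp σ fun i => G i (f (σ⁻¹ i))]
  simp

/-- A Gram matrix of standard basis vectors is singular unless these are distinct. -/
theorem det_of_ite_eq {n r : ℕ} (f : Fin n → Fin r) [Decidable (Function.Injective f)] :
    (Matrix.of fun i j => if f i = f j then (1 : ℝ) else 0).det =
      if Function.Injective f then 1 else 0 := by
  split_ifs with hf
  · have : (Matrix.of fun i j => if f i = f j then (1 : ℝ) else 0) = 1 := by
      ext i j
      simp [Matrix.one_apply, hf.eq_iff]
    rw [this, Matrix.det_one]
  · obtain ⟨i, j, hij, hne⟩ : ∃ i j, f i = f j ∧ i ≠ j := by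
      simpa [Function.Injective] using hf
    exact Matrix.det_zero_of_row_eq hne (funext fun k => by simp [hij])

/-- For fixed `f`, orthonormality of the coordinates turns the sum over `σ` into the determinant of
the matrix with entries `δ (f i) (f j)`, which is `1` exactly when `f` is injective. The mean
therefore counts injections. -/
theorem integrable_and_integral_det_gaussianPi (n r : ℕ) :
    Integrable (fun G : Fin n → Fin r → ℝ => (Matrix.of G * (Matrix.of G)ᵀ).det)
      (Measure.pi fun _ : Fin n => Measure.pi fun _ : Fin r => gaussianReal 0 1) ∧
    ∫ G : Fin n → Fin r → ℝ, (Matrix.of G * (Matrix.of G)ᵀ).det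
      ∂(Measure.pi fun _ : Fin n => Measure.pi fun _ : Fin r => gaussianReal 0 1) =
      (r.descFactorial n : ℝ) := by
  classical
  have hi : ∀ (f : Fin n → Fin r) (σ : Equiv.Perm (Fin n)),
      Integrable (fun G : Fin n → Fin r → ℝ => ((Equiv.Perm.sign σ : ℤ) : ℝ) *
        ∏ i, (G i (f (σ⁻¹ i)) * G i (f i)))
        (Measure.pi fun _ : Fin n => Measure.pi fun _ : Fin r => gaussianReal 0 1) := by
    intro f σ
    refine Integrable.const_mul ?_ _
    exact Integrable.fintype_prod (f := fun i (x : Fin r → ℝ) => x (f (σ⁻¹ i)) * x (f i))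
      fun i => (integrable_and_integral_mul_gaussianPi _ _).1
  simp_rw [det_mul_transpose_eq_sum]
  refine ⟨integrable_finsetSum _ fun f _ => integrable_finsetSum _ fun σ _ => hi f σ, ?_⟩
  rw [integral_finsetSum _ fun f _ => integrable_finsetSum _ fun σ _ => hi f σ]
  have h : ∀ f : Fin n → Fin r, ∫ G : Fin n → Fin r → ℝ, ∑ σ : Equiv.Perm (Fin n),
      ((Equiv.Perm.sign σ : ℤ) : ℝ) * ∏ i, (G i (f (σ⁻¹ i)) * G i (f i))
      ∂(Measure.pi fun _ : Fin n => Measure.pi fun _ : Fin r => gaussianReal 0 1) =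
      if Function.Injective f then 1 else 0 := by
    intro f
    rw [integral_finsetSum _ fun σ _ => hi f σ, ← det_of_ite_eq f, Matrix.det_apply']
    refine Finset.sum_congr rfl fun σ _ => ?_
    rw [integral_const_mul, integral_fintype_prod_eq_prod
      (fun i (x : Fin r → ℝ) => x (f (σ⁻¹ i)) * x (f i))]
    congr 1
    simp only [(integrable_and_integral_mul_gaussianPi _ _).2, Matrix.of_apply]
    rw [← Equiv.prod_comp σ]
    simp [eq_comm]
  simp_rw [h]
  rw [Finset.sum_boole, ← Fintype.card_subtype,
    Fintype.card_congr (Equiv.subtypeInjectiveEquivEmbedding (Fin n) (Fin r)),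
    Fintype.card_embedding_eq, Fintype.card_fin, Fintype.card_fin]

/-- The mean determinant of a Wishart matrix is a falling factorial. -/
theorem wishartDetMean_eq (n r : ℕ) : wishartDetMean n r = (r.descFactorial n : ℝ≥0∞) := by
  obtain ⟨hi, hv⟩ := integrable_and_integral_det_gaussianPi n r
  rw [wishartDetMean, lintegral_wishart (measurable_det n).ennreal_ofReal, gaussianMatrix,
    lintegral_map (continuous_det_mul_transpose_self n r).measurable.ennreal_ofReal
      (measurable_matrix_of n r),
    ← ofReal_integral_eq_lintegral_ofReal hi
      (ae_of_all _ fun G => det_mul_transpose_self_nonneg (Matrix.of G)), hv,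
    ENNReal.ofReal_natCast]

/-! ### Powers of the determinant and their moments -/

/-- The unnormalised moment of order `j` of the determinant of a Wishart matrix. -/
noncomputable def wishartDetMoment (n s j : ℕ) : ℝ :=
  ∏ i ∈ Finset.range j, ((s + 2 * i).descFactorial n : ℝ)

theorem wishartDetMoment_pos {n s : ℕ} (hns : n ≤ s) (j : ℕ) : 0 < wishartDetMoment n s j :=
  Finset.prod_pos fun i _ => by
    exact_mod_cast Nat.descFactorial_pos.2 (by lia)

/-- Each further factor `det M` adds two degrees of freedom and multiplies the total mass by the
current mean determinant. -/
theorem wishart_withDensity_det_pow (n s j : ℕ) :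
    (wishart n s).withDensity (fun M => ENNReal.ofReal M.det ^ j) =
      ENNReal.ofReal (wishartDetMoment n s j) • wishart n (s + 2 * j) := by
  have hd := (measurable_det n).ennreal_ofReal
  induction j with
  | zero => simp [wishartDetMoment]
  | succ j ih =>
    have h1 : (fun M : Matrix (Fin n) (Fin n) ℝ => ENNReal.ofReal M.det ^ (j + 1)) =
        (fun M => ENNReal.ofReal M.det ^ j) * fun M => ENNReal.ofReal M.det := by
      funext M; exact pow_succ _ _
    have hc : wishartDetMean n (s + 2 * j) ≠ ∞ := by
      rw [wishartDetMean_eq]; exact ENNReal.natCast_ne_top _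
    rw [h1, withDensity_mul _ (hd.pow_const j) hd, ih, withDensity_smul_measure,
      wishart_withDensity_det hc, smul_smul, wishartDetMean_eq, wishartDetMoment,
      wishartDetMoment, Finset.prod_range_succ, ENNReal.ofReal_mul
        (Finset.prod_nonneg fun i _ => Nat.cast_nonneg _), ENNReal.ofReal_natCast]
    rfl

theorem ae_wishart_det_nonneg (n s : ℕ) : ∀ᵐ M ∂(wishart n s), 0 ≤ M.det := by
  refine (ae_map_iff (measurable_mul_transpose_self n s).aemeasurable
    (measurableSet_le measurable_const (measurable_det n))).2 ?_
  exact ae_of_all _ fun G => det_mul_transpose_self_nonneg G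

theorem setLIntegral_det_pow_wishart (n s j : ℕ) {S : Set (Matrix (Fin n) (Fin n) ℝ)}
    (hS : MeasurableSet S) :
    ∫⁻ M in S, ENNReal.ofReal (M.det ^ j) ∂(wishart n s) =
      ENNReal.ofReal (wishartDetMoment n s j) * wishart n (s + 2 * j) S := by
  have h := congrArg (fun μ => μ S) (wishart_withDensity_det_pow n s j)
  simp only [withDensity_apply _ hS, Measure.smul_apply, smul_eq_mul] at h
  rw [← h]
  refine lintegral_congr_ae (ae_restrict_of_ae ?_)
  filter_upwards [ae_wishart_det_nonneg n s] with M hM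
  exact ENNReal.ofReal_pow hM j

theorem wishartDetMoment_nonneg (n s j : ℕ) : 0 ≤ wishartDetMoment n s j :=
  Finset.prod_nonneg fun _ _ => Nat.cast_nonneg _

theorem integrable_det_pow_wishart (n s j : ℕ) :
    Integrable (fun M : Matrix (Fin n) (Fin n) ℝ => M.det ^ j) (wishart n s) := by
  refine (lintegral_ofReal_ne_top_iff_integrable
    ((measurable_det n).pow_const j).aestronglyMeasurable ?_).1 ?_
  · filter_upwards [ae_wishart_det_nonneg n s] with M hM using pow_nonneg hM j
  · rw [← setLIntegral_univ, setLIntegral_det_pow_wishart n s j MeasurableSet.univ, measure_univ]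
    simp

theorem setIntegral_det_pow_wishart (n s j : ℕ) {S : Set (Matrix (Fin n) (Fin n) ℝ)}
    (hS : MeasurableSet S) :
    ∫ M in S, M.det ^ j ∂(wishart n s) =
      wishartDetMoment n s j * (wishart n (s + 2 * j)).real S := by
  rw [integral_eq_lintegral_of_nonneg_ae, setLIntegral_det_pow_wishart n s j hS, ENNReal.toReal_mul,
    ENNReal.toReal_ofReal (wishartDetMoment_nonneg n s j), Measure.real]
  · refine ae_restrict_of_ae ?_
    filter_upwards [ae_wishart_det_nonneg n s] with M hM using pow_nonneg hM j
  · exact ((measurable_det n).pow_const j).aestronglyMeasurable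

theorem integral_det_pow_wishart (n s j : ℕ) :
    ∫ M, M.det ^ j ∂(wishart n s) = wishartDetMoment n s j := by
  rw [← setIntegral_univ, setIntegral_det_pow_wishart n s j MeasurableSet.univ]
  simp

/-! ### Bounding total variation by moments -/

/-- A function of mean zero integrates over any set to at most half its `L¹` norm. -/
theorem abs_setIntegral_le_half_of_integral_eq_zero {Ω : Type*} [MeasurableSpace Ω]
    {μ : Measure Ω} {g : Ω → ℝ} (hg : Integrable g μ) (h0 : ∫ x, g x ∂μ = 0) {S : Set Ω}
    (hS : MeasurableSet S) : |∫ x in S, g x ∂μ| ≤ (∫ x, |g x| ∂μ) / 2 := by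
  have h1 := integral_add_compl hS hg
  have h2 := integral_add_compl hS hg.abs
  have h3 : |∫ x in S, g x ∂μ| ≤ ∫ x in S, |g x| ∂μ := abs_integral_le_integral_abs
  have h4 : |∫ x in Sᶜ, g x ∂μ| ≤ ∫ x in Sᶜ, |g x| ∂μ := abs_integral_le_integral_abs
  have h5 : ∫ x in Sᶜ, g x ∂μ = -∫ x in S, g x ∂μ := by linarith
  rw [h5, abs_neg] at h4
  linarith

/-- The moment of order `j` of the determinant of a Wishart matrix with `s` degrees of freedom,
divided by the mean determinant for `s + 2 * k` degrees of freedom. -/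
noncomputable def scaledDetMoment (n s k j : ℕ) : ℝ :=
  wishartDetMoment n s j / ((s + 2 * k).descFactorial n : ℝ) ^ j

/-- A polynomial majorant of `x ^ k * |x - 1|` bounds the total variation distance between Wishart
distributions. -/
theorem tvDist_wishart_le {n s : ℕ} (hns : n ≤ s) (k N : ℕ) (p : ℕ → ℝ)
    (hp : ∀ x : ℝ, 0 ≤ x → x ^ k * |x - 1| ≤ ∑ j ∈ Finset.range N, p j * x ^ j) :
    tvDist (wishart n (s + 2 * k)) (wishart n (s + 2 * k + 2)) ≤
      (∑ j ∈ Finset.range N, p j * (scaledDetMoment n s k j / scaledDetMoment n s k k)) / 2 := by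
  set c : ℝ := ((s + 2 * k).descFactorial n : ℝ) with hc
  have hc0 : 0 < c := by
    rw [hc]; exact_mod_cast Nat.descFactorial_pos.2 (by lia)
  have hK := wishartDetMoment_pos hns k
  set K := wishartDetMoment n s k with hKdef
  have hK1 : wishartDetMoment n s (k + 1) = K * c := by
    rw [hKdef, wishartDetMoment, Finset.prod_range_succ]; rfl
  -- The difference of the densities of the two laws with respect to `wishart n s`.
  let g : Matrix (Fin n) (Fin n) ℝ → ℝ := fun M => K⁻¹ * M.det ^ k - (K * c)⁻¹ * M.det ^ (k + 1)
  have hi1 := (integrable_det_pow_wishart n s k).const_mul K⁻¹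
  have hi2 := (integrable_det_pow_wishart n s (k + 1)).const_mul (K * c)⁻¹
  have hgi : Integrable g (wishart n s) := hi1.sub hi2
  have hgS : ∀ S : Set (Matrix (Fin n) (Fin n) ℝ), MeasurableSet S →
      ∫ M in S, g M ∂(wishart n s) =
        (wishart n (s + 2 * k)).real S - (wishart n (s + 2 * k + 2)).real S := by
    intro S hS
    have h := integral_sub (hi1.integrableOn (s := S)) (hi2.integrableOn (s := S))
    rw [integral_const_mul, integral_const_mul, setIntegral_det_pow_wishart n s k hS,
      setIntegral_det_pow_wishart n s (k + 1) hS, hK1, ← hKdef,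
      inv_mul_cancel_left₀ hK.ne', inv_mul_cancel_left₀ (mul_pos hK hc0).ne'] at h
    exact h
  have hg0 : ∫ M, g M ∂(wishart n s) = 0 := by
    rw [← setIntegral_univ, hgS _ MeasurableSet.univ]; simp
  have habs : ∫ M, |g M| ∂(wishart n s) ≤
      ∑ j ∈ Finset.range N, p j * (scaledDetMoment n s k j / scaledDetMoment n s k k) := by
    have hint : ∀ j ∈ Finset.range N, Integrable
        (fun M : Matrix (Fin n) (Fin n) ℝ => K⁻¹ * c ^ k * (p j / c ^ j) * M.det ^ j)
        (wishart n s) :=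
      fun j _ => (integrable_det_pow_wishart n s j).const_mul _
    calc ∫ M, |g M| ∂(wishart n s)
        ≤ ∫ M, ∑ j ∈ Finset.range N, K⁻¹ * c ^ k * (p j / c ^ j) * M.det ^ j ∂(wishart n s) := by
          refine integral_mono_ae hgi.abs (integrable_finsetSum _ hint) ?_
          filter_upwards [ae_wishart_det_nonneg n s] with M hM
          -- Here `x = det M / c` is the likelihood ratio of the two laws being compared.
          have h1 := hp (M.det / c) (by positivity)
          have h2 : |g M| = K⁻¹ * c ^ k * ((M.det / c) ^ k * |M.det / c - 1|) := by
            have h3 : g M = K⁻¹ * c ^ k * (M.det / c) ^ k * -(M.det / c - 1) := by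
              simp only [g]
              rw [div_pow]
              field_simp
              ring
            rw [h3, abs_mul, abs_neg, abs_of_nonneg (by positivity), mul_assoc]
          have h4 : ∑ j ∈ Finset.range N, K⁻¹ * c ^ k * (p j / c ^ j) * M.det ^ j =
              K⁻¹ * c ^ k * ∑ j ∈ Finset.range N, p j * (M.det / c) ^ j := by
            rw [Finset.mul_sum]
            exact Finset.sum_congr rfl fun j _ => by rw [div_pow]; ring
          rw [h2, h4]
          exact mul_le_mul_of_nonneg_left h1 (by positivity)
      _ = _ := by
          rw [integral_finsetSum _ hint]
          refine Finset.sum_congr rfl fun j _ => ?_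
          rw [integral_const_mul, integral_det_pow_wishart, scaledDetMoment, scaledDetMoment,
            ← hc, ← hKdef]
          field_simp
  refine ciSup_le fun S => ?_
  rw [← hgS S S.2]
  have := abs_setIntegral_le_half_of_integral_eq_zero hgi hg0 S.2
  linarith

/-! ### The polynomial majorant -/

/-- Coefficients of a polynomial majorant of `x ^ 4 * |x - 1|` on the half line, up to the factor
`2168277829117027405557780000`. -/
noncomputable def majorantCoeff (j : ℕ) : ℝ :=
  [73293102975042252638899200,
    -1439655812640912161246012160,
    11746080655995708523591527152,
    -50253034277326882072003281144,
    123771868107948186217056100259,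
    -171839519635826340514525843950,
    134804209176967952131884282287,
    -59470129561380481092502977660,
    14677769529159463136563908876,
    -1867717672632932377632604992,
    94839934439121934255909632].getD j 0 / 2168277829117027405557780000

theorem sum_majorantCoeff (x : ℝ) :
    ∑ j ∈ Finset.range 11, majorantCoeff j * x ^ j =
      (73293102975042252638899200 +
      (-1439655812640912161246012160) * x ^ 1 +
      (11746080655995708523591527152) * x ^ 2 +
      (-50253034277326882072003281144) * x ^ 3 +
      (123771868107948186217056100259) * x ^ 4 +
      (-171839519635826340514525843950) * x ^ 5 +
      (134804209176967952131884282287) * x ^ 6 +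
      (-59470129561380481092502977660) * x ^ 7 +
      (14677769529159463136563908876) * x ^ 8 +
      (-1867717672632932377632604992) * x ^ 9 +
      (94839934439121934255909632) * x ^ 10) / 2168277829117027405557780000 := by
  simp only [Finset.sum_range_succ, Finset.sum_range_zero, majorantCoeff, List.getD_cons_zero,
    List.getD_cons_succ]
  ring

theorem pow_four_mul_abs_sub_one_le (x : ℝ) (hx : 0 ≤ x) :
    x ^ 4 * |x - 1| ≤ ∑ j ∈ Finset.range 11, majorantCoeff j * x ^ j := by
  -- This is the common denominator times the majorant minus `x^4 (x - 1)`. The squared factor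
  -- places double contacts at `4/3`, `8/3` and `11/2`, all beyond `1`; the cofactor is visibly
  -- positive for `x ≥ 0`.
  have h1 : 0 ≤ ((3 * x - 4) * (3 * x - 8) * (2 * x - 11)) ^ 2 *
      (292715847034326957579968 * (x ^ 2 - 7/20 * x + 3/100) ^ 2 +
        336673117470485401695471/25 * (x - 3/20) ^ 2 + 9707342866816777913808/5 * x ^ 3 +
        5701756356907480861749/50 * x + 250813028057077183271049/10000) := by
    positivity
  -- Likewise for the majorant minus `x^4 (1 - x)`, with double contacts at `3/8` and `5/7`.
  have h2 : 0 ≤ ((8 * x - 3) * (7 * x - 5)) ^ 2 * ((x - 1/6) ^ 2 *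
      (30242326032883269852012 * (x ^ 2 - 43/5 * x + 15) ^ 2 +
        3908196682716702672528012/25 * (x - 99/20) ^ 2 + 2803065459710941671912/5 * x ^ 3 +
        8921222643995160471594/125 * x + 124365224466942160911768597/2500) +
      72228855732261648107240 * x + 86850288340883962650980/3) := by
    positivity
  rw [sum_majorantCoeff, le_div_iff₀ (by norm_num)]
  rcases abs_cases (x - 1) with ⟨h, -⟩ | ⟨h, -⟩ <;> rw [h] <;> linarith

/-! ### Asymptotics of falling factorials and scaled moments -/

open Filter Topology in
/-- If `n s` is asymptotically `α * s`, then shifting the base of a falling factorial with `n s`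
factors by `a` multiplies it asymptotically by `(1 - α)⁻¹ ^ a`. -/
theorem tendsto_descFactorial_ratio {n : ℕ → ℕ} {α : ℝ} (hα : α < 1)
    (hn : Tendsto (fun s => (n s : ℝ) / s) atTop (𝓝 α)) (hns : ∀ᶠ s in atTop, n s ≤ s) (a : ℕ) :
    Tendsto (fun s => ((s + a).descFactorial (n s) : ℝ) / (s.descFactorial (n s) : ℝ)) atTop
      (𝓝 ((1 - α)⁻¹ ^ a)) := by
  induction a with
  | zero =>
    rw [pow_zero]
    refine tendsto_const_nhds.congr' ?_
    filter_upwards [hns] with s hs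
    have : (s.descFactorial (n s) : ℝ) ≠ 0 := by
      exact_mod_cast (Nat.descFactorial_pos.2 hs).ne'
    rw [add_zero, div_self this]
  | succ a ih =>
    rw [pow_succ]
    have hinv : Tendsto (fun s : ℕ => ((s : ℝ))⁻¹) atTop (𝓝 0) :=
      tendsto_inv_atTop_zero.comp tendsto_natCast_atTop_atTop
    have h1 : Tendsto (fun s : ℕ => (1 + ((a : ℝ) + 1) * (s : ℝ)⁻¹) /
        (1 + ((a : ℝ) + 1) * (s : ℝ)⁻¹ - (n s : ℝ) / s)) atTop (𝓝 (1 - α)⁻¹) := by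
      have h2 : Tendsto (fun s : ℕ => 1 + ((a : ℝ) + 1) * (s : ℝ)⁻¹) atTop (𝓝 1) := by
        simpa using (hinv.const_mul ((a : ℝ) + 1)).const_add 1
      have h3 := h2.div (h2.sub hn) (sub_pos.2 hα).ne'
      rwa [one_div] at h3
    refine (ih.mul h1).congr' ?_
    filter_upwards [hns, eventually_gt_atTop 0] with s hs hs0
    have hs0' : (s : ℝ) ≠ 0 := by exact_mod_cast hs0.ne'
    have hc : (s.descFactorial (n s) : ℝ) ≠ 0 := by
      exact_mod_cast (Nat.descFactorial_pos.2 hs).ne'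
    -- Raising the base from `s + a` to `s + a + 1` multiplies the falling factorial by `(s + a + 1)
    -- / (s + a + 1 - n s)`, which tends to `(1 - α)⁻¹`.
    have h3 : ((s : ℝ) + a + 1 - n s) * ((s + (a + 1)).descFactorial (n s) : ℝ) =
        (s + a + 1) * ((s + a).descFactorial (n s) : ℝ) := by
      have := Nat.succ_descFactorial (s + a) (n s)
      have h4 : ((s + a + 1 - n s : ℕ) : ℝ) = (s : ℝ) + a + 1 - n s := by
        rw [Nat.cast_sub (by lia)]; push_cast; ring
      rw [← h4]
      exact_mod_cast this
    have h5 : (s : ℝ) + a + 1 - n s ≠ 0 := by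
      have : (n s : ℝ) ≤ s := by exact_mod_cast hs
      have : (0 : ℝ) ≤ a := Nat.cast_nonneg a
      intro h; linarith
    have h6 : (1 + ((a : ℝ) + 1) * (s : ℝ)⁻¹) / (1 + ((a : ℝ) + 1) * (s : ℝ)⁻¹ - (n s : ℝ) / s) =
        (s + a + 1) / (s + a + 1 - n s) := by
      have e1 : (1 + ((a : ℝ) + 1) * (s : ℝ)⁻¹) = (s + a + 1) / s := by field_simp; ring
      rw [e1, ← sub_div, div_div_div_cancel_right₀ hs0']
    rw [h6, div_mul_div_comm, div_eq_div_iff (mul_ne_zero hc h5) hc]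
    linear_combination (-(s.descFactorial (n s) : ℝ)) * h3

open Filter Topology in
/-- The limits of the scaled moments of the determinant of Wishart matrices. -/
theorem tendsto_scaledDetMoment {n : ℕ → ℕ} {α : ℝ} (hα : α < 1)
    (hn : Tendsto (fun s => (n s : ℝ) / s) atTop (𝓝 α)) (hns : ∀ᶠ s in atTop, n s ≤ s)
    (k j : ℕ) :
    Tendsto (fun s => scaledDetMoment (n s) s k j) atTop
      (𝓝 (∏ i ∈ Finset.range j, (1 - α)⁻¹ ^ (2 * i) / (1 - α)⁻¹ ^ (2 * k))) := by
  have hq : (1 - α)⁻¹ ^ (2 * k) ≠ 0 := pow_ne_zero _ (inv_ne_zero (sub_pos.2 hα).ne')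
  have h := tendsto_finsetProd (Finset.range j) fun i _ =>
    (tendsto_descFactorial_ratio hα hn hns (2 * i)).div
      (tendsto_descFactorial_ratio hα hn hns (2 * k)) hq
  refine h.congr' ?_
  filter_upwards [hns] with s hs
  have hc : (s.descFactorial (n s) : ℝ) ≠ 0 := by
    exact_mod_cast (Nat.descFactorial_pos.2 hs).ne'
  simp only [Pi.div_apply, div_div_div_cancel_right₀ hc]
  rw [Finset.prod_div_distrib, Finset.prod_const, Finset.card_range]
  rfl

/-! ### The numerical bound and the conclusion -/

/-- With `q = 10/9` the quotient of products is `q^(m(m-1))` for `m = j - 4`. The log-normal law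
with these moments has `E|x - 1| / 2` about `0.18`, which leaves room for the error of the majorant.
-/
theorem sum_majorantCoeff_mul_limit_lt :
    (∑ j ∈ Finset.range 11, majorantCoeff j *
      ((∏ i ∈ Finset.range j, (1 - (0.1 : ℝ))⁻¹ ^ (2 * i) / (1 - (0.1 : ℝ))⁻¹ ^ (2 * 4)) /
        (∏ i ∈ Finset.range 4, (1 - (0.1 : ℝ))⁻¹ ^ (2 * i) / (1 - (0.1 : ℝ))⁻¹ ^ (2 * 4)))) / 2
      < 0.2 := by
  simp only [Finset.sum_range_succ, Finset.sum_range_zero, Finset.prod_range_succ,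
    Finset.prod_range_zero, majorantCoeff, List.getD_cons_zero, List.getD_cons_succ]
  norm_num

open Filter Topology in
theorem mainTheorem5 :
    ∃ c : ℕ, ∀ r : ℕ, c ≤ r →
      tvDist (wishart ⌊(0.1 : ℝ) * (r : ℝ)⌋₊ r) (wishart ⌊(0.1 : ℝ) * (r : ℝ)⌋₊ (r + 2)) ≤ 0.2 := by
  have hcast : ∀ s : ℕ, ((s + 2 * 4 : ℕ) : ℝ) = s + 8 := fun s => by push_cast; ring
  have hn : Tendsto (fun s : ℕ => ((⌊(0.1 : ℝ) * ((s + 2 * 4 : ℕ) : ℝ)⌋₊ : ℕ) : ℝ) / s) atTop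
      (𝓝 0.1) := by
    have hinv : Tendsto (fun s : ℕ => ((s : ℝ))⁻¹) atTop (𝓝 0) :=
      tendsto_inv_atTop_zero.comp tendsto_natCast_atTop_atTop
    -- The floor lies between `0.1 (s + 8) - 1 = 0.1 s - 0.2` and `0.1 (s + 8) = 0.1 s + 0.8`.
    have hlo : Tendsto (fun s : ℕ => (0.1 : ℝ) - 0.2 * (s : ℝ)⁻¹) atTop (𝓝 0.1) := by
      simpa using (hinv.const_mul (0.2 : ℝ)).const_sub (0.1 : ℝ)
    have hhi : Tendsto (fun s : ℕ => (0.1 : ℝ) + 0.8 * (s : ℝ)⁻¹) atTop (𝓝 0.1) := by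
      simpa using (hinv.const_mul (0.8 : ℝ)).const_add (0.1 : ℝ)
    refine tendsto_of_tendsto_of_tendsto_of_le_of_le' hlo hhi ?_ ?_
    all_goals
      filter_upwards [eventually_gt_atTop 0] with s hs
      have hs' : (0 : ℝ) < s := by exact_mod_cast hs
      rw [hcast]
    · rw [le_div_iff₀ hs', sub_mul, mul_assoc, inv_mul_cancel₀ hs'.ne']
      have := Nat.lt_floor_add_one ((0.1 : ℝ) * ((s : ℝ) + 8))
      linarith
    · rw [div_le_iff₀ hs', add_mul, mul_assoc 0.8, inv_mul_cancel₀ hs'.ne']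
      have := Nat.floor_le (by positivity : (0 : ℝ) ≤ 0.1 * ((s : ℝ) + 8))
      linarith
  have hns : ∀ᶠ s : ℕ in atTop, ⌊(0.1 : ℝ) * ((s + 2 * 4 : ℕ) : ℝ)⌋₊ ≤ s := by
    filter_upwards [eventually_ge_atTop 1] with s hs
    have hs' : (1 : ℝ) ≤ s := by exact_mod_cast hs
    refine Nat.floor_le_of_le ?_
    rw [hcast]
    linarith
  have hm := fun j => tendsto_scaledDetMoment (by norm_num) hn hns 4 j
  have h4 : (∏ i ∈ Finset.range 4, (1 - (0.1 : ℝ))⁻¹ ^ (2 * i) / (1 - (0.1 : ℝ))⁻¹ ^ (2 * 4)) ≠ 0 :=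
    Finset.prod_ne_zero_iff.2 fun i _ => by positivity
  have hlim := (tendsto_finsetSum (Finset.range 11) fun j _ =>
    ((hm j).div (hm 4) h4).const_mul (majorantCoeff j)).div_const 2
  obtain ⟨c, hc⟩ := eventually_atTop.1
    ((hlim.eventually (gt_mem_nhds sum_majorantCoeff_mul_limit_lt)).and hns)
  -- The asymptotics run in the base `s = r - 8`, so the threshold shifts by `8`.
  refine ⟨c + 2 * 4, fun r hr => ?_⟩
  obtain ⟨s, rfl⟩ : ∃ s, r = s + 2 * 4 := ⟨r - 2 * 4, by lia⟩
  obtain ⟨h1, h2⟩ := hc s (by lia)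
  exact (tvDist_wishart_le h2 4 11 majorantCoeff pow_four_mul_abs_sub_one_le).trans h1.le
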